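/- Let $n \ge 2$, let $\mathscr{C}_n$ be the set of $n$-cycles in the group of permutations of $\{1,\dots,n\}$, and let $\rho = (1\,2\,\cdots\,n)$. For $\nu \in \mathscr{C}_n$, the combinatorial type $[\nu]$ is the set of all conjugates $\rho^j \nu \rho^{-j}$, $j \in \mathbb{Z}$; the symmetry order $\operatorname{sym}(\nu)$ is the order of the group $\{\rho^j : \rho^j \nu \rho^{-j} = \nu\}$; and the degree is $$\deg(\nu) = \#\{1 \le i \le n-1 : \nu(i) > \nu(i+1)\} + \begin{cases} 1 & \text{if } \nu(n) > \nu(1), \\ 0 & \text{if } \nu(n) < \nu(1). \end{cases}$$ For an integer $k \ge 2$ let $\mathbf{m}_k : \mathbb{R}/\mathbb{Z} \to \mathbb{R}/\mathbb{Z}$, $\mathbf{m}_k(x) = kx \pmod{\mathbb{Z}}$. A period $n$ orbit of $\mathbf{m}_k$ is the orbit of a point of least period $n$. Such an orbit, written $\{x_1,\dots,x_n\}$ with representatives $0 < x_1 < \cdots < x_n < 1$, realizes $\nu \in \mathscr{C}_n$ if $\mathbf{m}_k(x_i) = x_{\nu(i)}$ for all $i$, and it realizes $[\nu]$ if it realizes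 some element of $[\nu]$. Theorem. Let $\nu \in \mathscr{C}_n$ have degree $d$ and symmetry order $s$, and let $k \ge \max\{d,2\}$ be an integer. Then there are precisely $$\frac{k-1}{s}\binom{n+k-d-1}{n-1}$$ period $n$ orbits of $\mathbf{m}_k$ that realize the combinatorial type $[\nu]$. -/

import Mathlib

namespace CircleCycles

/-- The rotation `ρ = (1 2 ⋯ n)`; the set `{1, …, n}` is modelled by `Fin n`, in its order. -/
def rho (n : ℕ) : Equiv.Perm (Fin n) := finRotate n

/-- The rotation group, generated by `ρ`. -/
def rotationGroup (n : ℕ) : Subgroup (Equiv.Perm (Fin n)) := Subgroup.zpowers (rho n)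

/-- `ν` is an `n`-cycle: a cycle that moves every one of the `n` points. -/
def IsNCycle {n : ℕ} (ν : Equiv.Perm (Fin n)) : Prop :=
  ν.IsCycle ∧ ν.support = Finset.univ

/-- The combinatorial type `[ν]`: the orbit of `ν` under conjugation by the rotation group. -/
def combinatorialType {n : ℕ} (ν : Equiv.Perm (Fin n)) : Set (Equiv.Perm (Fin n)) :=
  {μ | ∃ g ∈ rotationGroup n, μ = g * ν * g⁻¹}

/-- The symmetry order: the order of the stabilizer of `ν` under conjugation by rotations. -/
noncomputable def symOrder {n : ℕ} (ν : Equiv.Perm (Fin n)) : ℕ :=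
  Set.ncard {g : Equiv.Perm (Fin n) | g ∈ rotationGroup n ∧ g * ν * g⁻¹ = ν}

/-- The descent number: the number of `i` with a successor `i + 1 ≤ n` and `ν i > ν (i + 1)`. -/
noncomputable def descentNumber {n : ℕ} (ν : Equiv.Perm (Fin n)) : ℕ :=
  Set.ncard {i : Fin n | ∃ h : (i : ℕ) + 1 < n, ν ⟨(i : ℕ) + 1, h⟩ < ν i}

/-- The degree (cyclic descent number): the last point counts as a further descent when its image
exceeds the image of the first point. (The value at `n = 0` is irrelevant.) -/
noncomputable def degree {n : ℕ} (ν : Equiv.Perm (Fin n)) : ℕ :=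
  if h : 0 < n then
    if ν ⟨0, h⟩ < ν ⟨n - 1, Nat.sub_lt h Nat.one_pos⟩ then descentNumber ν + 1
    else descentNumber ν
  else 0

/-- The map `x ↦ k x (mod ℤ)` of the circle `ℝ / ℤ`. -/
noncomputable def mulMap (k : ℕ) (x : UnitAddCircle) : UnitAddCircle := k • x

/-- `O` is a period `n` orbit of `x ↦ k x`: the forward orbit of a point of least period `n`
(used for `n ≥ 1` only). -/
def IsPeriodicOrbit (k n : ℕ) (O : Set UnitAddCircle) : Prop :=
  ∃ x : UnitAddCircle, Function.minimalPeriod (mulMap k) x = n ∧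
    O = Set.range fun j : ℕ => (mulMap k)^[j] x

/-- `O` realizes `ν`: when its points are labelled by representatives
`0 < x₁ < ⋯ < xₙ < 1`, the map `x ↦ k x` sends `xᵢ` to `x_{ν(i)}` for every `i`. -/
def Realizes (k : ℕ) {n : ℕ} (O : Set UnitAddCircle) (ν : Equiv.Perm (Fin n)) : Prop :=
  ∃ x : Fin n → ℝ, StrictMono x ∧ (∀ i, 0 < x i ∧ x i < 1) ∧
    O = Set.range (fun i => (x i : UnitAddCircle)) ∧
    ∀ i, mulMap k (x i : UnitAddCircle) = (x (ν i) : UnitAddCircle)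

/-- `O` realizes the combinatorial type `[ν]`: it realizes some rotation conjugate of `ν`. -/
def RealizesType (k : ℕ) {n : ℕ} (O : Set UnitAddCircle) (ν : Equiv.Perm (Fin n)) : Prop :=
  ∃ μ ∈ combinatorialType ν, Realizes k O μ

end CircleCycles

namespace CircleCycles

/-! ### Descents, cyclic descents and conjugation by rotations -/

/-! An orbit realizing an `n`-cycle `μ` satisfies `k * x i = x (μ i) + a i` with integer digits `0 ≤
a i < k`. The digits determine `x` (`existsUnique_solution`), and `x` is increasing exactly when `i
↦ (a i, μ i)` is lexicographically increasing (`exists_digits`, `solution_strictMono`). So `a` must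
increase weakly at ascents of `μ` and strictly at descents; adding the number of earlier ascents
makes it strictly increasing, which gives `(n - 1 + k - des μ).choose n` orbits (`ncard_realizes`).

It remains to sum over the `n` rotation conjugates of `ν`, each element of the type occurring `s`
times. The degree `d` is rotation invariant, so a conjugate has `d - 1` or `d` descents, according
to whether its last point is a cyclic descent or not. The former holds for `d - 1` rotations
(`card_rotConj_lt_add_one`). With `N = n - 1 + k - d`, Pascal's rule gives the sum `n * N.choose n +
(d - 1) * N.choose (n - 1) = (k - 1) * N.choose (n - 1)`. -/

theorem val_sub_eq_ite {m : ℕ} (x y : Fin (m + 2)) :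
    ((y - x : Fin (m + 2)).val : ℤ) =
      (y.val : ℤ) - x.val + if y < x then ((m : ℤ) + 2) else 0 := by
  have hx := x.isLt
  have hy := y.isLt
  rw [Fin.val_sub]
  split_ifs with h
  · rw [Fin.lt_def] at h
    rw [Nat.mod_eq_of_lt (by omega)]
    omega
  · rw [Fin.lt_def] at h
    rw [show m + 2 - x.val + y.val = (y.val - x.val) + (m + 2) by omega, Nat.add_mod_right,
      Nat.mod_eq_of_lt (by omega)]
    omega

theorem sum_comp_add_one {m : ℕ} (f : Fin (m + 2) → ℤ) : ∑ p, f (p + 1) = ∑ p, f p :=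
  Equiv.sum_comp (Equiv.addRight (1 : Fin (m + 2))) f

theorem descentNumber_eq_card {m : ℕ} (ν : Equiv.Perm (Fin (m + 2))) :
    descentNumber ν = (Finset.univ.filter fun i : Fin (m + 1) => ν i.succ < ν i.castSucc).card := by
  unfold descentNumber
  rw [← Set.ncard_coe_finset]
  symm
  refine Set.ncard_congr (fun i _ => i.castSucc) ?_ ?_ ?_
  · intro i hi
    simp only [Finset.coe_filter, Finset.mem_univ, true_and, Set.mem_ofPred_eq] at hi ⊢
    exact ⟨by simp only [Fin.val_castSucc]; omega, hi⟩
  · intro a b _ _ h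
    exact Fin.castSucc_injective _ h
  · rintro b ⟨h, hb⟩
    refine ⟨⟨b.val, by omega⟩, ?_, rfl⟩
    simpa using hb

theorem degree_eq_descentNumber_add {m : ℕ} (ν : Equiv.Perm (Fin (m + 2))) :
    degree ν = descentNumber ν + if ν 0 < ν (Fin.last (m + 1)) then 1 else 0 := by
  unfold degree
  rw [dif_pos (by omega)]
  have h0 : (⟨0, by omega⟩ : Fin (m + 2)) = 0 := rfl
  have h1 : (⟨m + 2 - 1, by omega⟩ : Fin (m + 2)) = Fin.last (m + 1) := rfl
  rw [h0, h1]
  split_ifs <;> rfl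

theorem degree_eq_card {m : ℕ} (ν : Equiv.Perm (Fin (m + 2))) :
    degree ν = (Finset.univ.filter fun p => ν (p + 1) < ν p).card := by
  rw [degree_eq_descentNumber_add, descentNumber_eq_card, Finset.card_filter, Finset.card_filter,
    Fin.sum_univ_castSucc (fun p => if ν (p + 1) < ν p then 1 else 0), Fin.last_add_one]
  simp only [Fin.coeSucc_eq_succ]

/-- The integer differences telescope around the circle; each cyclic descent wraps once and
contributes `n`. The left side sees only differences mod `n`, whence the rotation invariance of the
degree. -/
theorem sum_val_sub_eq {m : ℕ} (ν : Equiv.Perm (Fin (m + 2))) :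
    ∑ p, ((ν (p + 1) - ν p : Fin (m + 2)).val : ℤ) = ((m : ℤ) + 2) * degree ν := by
  simp_rw [val_sub_eq_ite]
  rw [Finset.sum_add_distrib, Finset.sum_sub_distrib,
    sum_comp_add_one (fun p => ((ν p).val : ℤ)), sub_self, zero_add, degree_eq_card,
    ← Finset.sum_filter, Finset.sum_const, nsmul_eq_mul, mul_comm]

/-- The conjugate of `ν` by the rotation through `c` steps. -/
def rotConj {m : ℕ} (ν : Equiv.Perm (Fin (m + 2))) (c : Fin (m + 2)) :
    Equiv.Perm (Fin (m + 2)) :=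
  Equiv.addRight c * ν * (Equiv.addRight c)⁻¹

theorem rotConj_apply {m : ℕ} (ν : Equiv.Perm (Fin (m + 2))) (c p : Fin (m + 2)) :
    rotConj ν c p = ν (p - c) + c := by
  simp [rotConj, sub_eq_add_neg]

theorem degree_rotConj {m : ℕ} (ν : Equiv.Perm (Fin (m + 2))) (c : Fin (m + 2)) :
    degree (rotConj ν c) = degree ν := by
  have h := sum_val_sub_eq (rotConj ν c)
  simp_rw [rotConj_apply, add_sub_add_right_eq_sub] at h
  have h2 := Equiv.sum_comp (Equiv.subRight c)
    (fun p => ((ν (p + 1) - ν p : Fin (m + 2)).val : ℤ))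
  simp only [Equiv.subRight_apply, sub_add_eq_add_sub] at h2
  rw [h2, sum_val_sub_eq] at h
  have := mul_left_cancel₀ (by positivity) h
  exact_mod_cast this.symm

theorem val_sub_one {m : ℕ} {x : Fin (m + 2)} (hx : x ≠ 0) :
    ((x - 1 : Fin (m + 2)).val : ℤ) = x.val - 1 := by
  rw [val_sub_eq_ite, if_neg]
  · simp
  · rw [not_lt, Fin.le_def, Fin.val_one]
    exact Nat.one_le_iff_ne_zero.2 fun h => hx (Fin.ext h)

/-- A fixed point free permutation of degree `d` has `d - 1` rotation conjugates whose last point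
is a cyclic descent. -/
theorem card_rotConj_lt_add_one {m : ℕ} (ν : Equiv.Perm (Fin (m + 2))) (hν : ∀ p, ν p ≠ p) :
    (Finset.univ.filter fun c => rotConj ν c 0 < rotConj ν c (Fin.last (m + 1))).card + 1 =
      degree ν := by
  have h1 : (Finset.univ.filter fun c => rotConj ν c 0 < rotConj ν c (Fin.last (m + 1))).card =
      (Finset.univ.filter fun p => ν (p + 1) - (p + 1) < ν p - (p + 1)).card := by
    -- For `c = -1 - p`, the last and first points of the conjugate come from `p` and `p + 1`.
    rw [Finset.card_filter, Finset.card_filter, ← Equiv.sum_comp (Equiv.subLeft (-1))]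
    refine Finset.sum_congr rfl fun p _ => ?_
    have hl : Fin.last (m + 1) = -1 := by
      rw [eq_neg_iff_add_eq_zero]; simp
    have e1 : -1 - (-1 - p) = p := by abel
    have e2 : 0 - (-1 - p) = p + 1 := by abel
    have e3 : ∀ x : Fin (m + 2), x + (-1 - p) = x - (p + 1) := fun x => by abel
    simp only [Equiv.subLeft_apply, rotConj_apply, hl, e1, e2, e3]
  -- Since `ν p ≠ p`, subtracting one from `ν p - p` does not wrap. Summed over `p`, the
  -- displacements cancel and the terms `+ 1` add up to `n`, one unit of degree.
  have key : ∀ p, ((ν (p + 1) - ν p : Fin (m + 2)).val : ℤ) =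
      ((ν (p + 1) - (p + 1)).val : ℤ) - ((ν p - p).val : ℤ) + 1 +
        if ν (p + 1) - (p + 1) < ν p - (p + 1) then ((m : ℤ) + 2) else 0 := by
    intro p
    have h := val_sub_eq_ite (ν p - (p + 1)) (ν (p + 1) - (p + 1))
    rw [sub_sub_sub_cancel_right] at h
    have h' := val_sub_one (sub_ne_zero.2 (hν p))
    rw [sub_sub] at h'
    rw [h, h']
    ring
  have h2 := sum_val_sub_eq ν
  simp_rw [key] at h2
  rw [Finset.sum_add_distrib, Finset.sum_add_distrib, Finset.sum_sub_distrib,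
    sum_comp_add_one (fun p => ((ν p - p).val : ℤ)), sub_self, zero_add,
    ← Finset.sum_filter, Finset.sum_const, Finset.sum_const, ← h1] at h2
  simp only [Finset.card_univ, Fintype.card_fin, nsmul_eq_mul] at h2
  push_cast at h2
  have h3 : ((m : ℤ) + 2) * ((Finset.univ.filter fun c =>
      rotConj ν c 0 < rotConj ν c (Fin.last (m + 1))).card + 1) = ((m : ℤ) + 2) * degree ν := by
    linarith
  exact_mod_cast mul_left_cancel₀ (by positivity) h3

/-! ### Counting digit functions -/

theorem ncard_strictMono_lt (n N : ℕ) :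
    {b : Fin n → ℕ | StrictMono b ∧ ∀ i, b i < N}.Finite ∧
    {b : Fin n → ℕ | StrictMono b ∧ ∀ i, b i < N}.ncard = N.choose n := by
  have hfin : {b : Fin n → ℕ | StrictMono b ∧ ∀ i, b i < N}.Finite := by
    refine (Set.Finite.pi' (ι := Fin n) (t := fun _ => Set.Iio N)
      fun _ => Set.finite_Iio N).subset ?_
    rintro b ⟨_, hb⟩ i
    exact hb i
  refine ⟨hfin, ?_⟩
  have : N.choose n = (Finset.powersetCard n (Finset.range N)).card := by simp
  rw [this, ← Set.ncard_coe_finset]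
  refine Set.ncard_congr (fun b _ => Finset.univ.image b) ?_ ?_ ?_
  · rintro b ⟨hb, hN⟩
    simp only [Finset.mem_coe, Finset.mem_powersetCard]
    refine ⟨?_, ?_⟩
    · intro x hx
      obtain ⟨i, _, rfl⟩ := Finset.mem_image.1 hx
      exact Finset.mem_range.2 (hN i)
    · rw [Finset.card_image_of_injective _ hb.injective]; simp
  · rintro a b ⟨ha, _⟩ ⟨hb, _⟩ h
    rw [← StrictMono.range_inj ha hb]
    have := congrArg (fun s : Finset ℕ => (s : Set ℕ)) h
    simpa using this
  · intro s hs
    simp only [Finset.mem_coe, Finset.mem_powersetCard] at hs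
    refine ⟨s.orderEmbOfFin hs.2, ⟨(s.orderEmbOfFin hs.2).strictMono, fun i => ?_⟩, ?_⟩
    · exact Finset.mem_range.1 (hs.1 (Finset.orderEmbOfFin_mem s hs.2 i))
    · apply Finset.coe_injective
      simp

/-- The digit functions compatible with `μ`: bounded by `k`, and making `i ↦ (a i, μ i)` strictly
increasing in the lexicographic order. -/
def digitSet {m : ℕ} (k : ℕ) (μ : Equiv.Perm (Fin (m + 2))) : Set (Fin (m + 2) → ℕ) :=
  {a | (∀ i, a i < k) ∧ StrictMono fun i => toLex (a i, μ i)}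

/-- The number of ascents of `μ` at points before `i`. -/
def ascentsBefore {m : ℕ} (μ : Equiv.Perm (Fin (m + 2))) (i : Fin (m + 2)) : ℕ :=
  (Finset.univ.filter fun j : Fin (m + 1) => j.castSucc < i ∧ μ j.castSucc < μ j.succ).card

theorem ascentsBefore_zero {m : ℕ} (μ : Equiv.Perm (Fin (m + 2))) : ascentsBefore μ 0 = 0 := by
  simp [ascentsBefore]

theorem ascentsBefore_succ {m : ℕ} (μ : Equiv.Perm (Fin (m + 2))) (i : Fin (m + 1)) :
    ascentsBefore μ i.succ =
      ascentsBefore μ i.castSucc + if μ i.castSucc < μ i.succ then 1 else 0 := by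
  unfold ascentsBefore
  have : (if μ i.castSucc < μ i.succ then 1 else 0) =
      ∑ j : Fin (m + 1), if j = i ∧ μ j.castSucc < μ j.succ then 1 else 0 := by
    rw [Finset.sum_eq_single i] <;> simp +contextual
  rw [Finset.card_filter, Finset.card_filter, this, ← Finset.sum_add_distrib]
  refine Finset.sum_congr rfl fun j _ => ?_
  have h1 : j.castSucc < i.succ ↔ j ≤ i := Fin.castSucc_lt_succ_iff
  simp only [h1, Fin.castSucc_lt_castSucc_iff]
  by_cases h : μ j.castSucc < μ j.succ
  · rcases lt_trichotomy j i with hj | hj | hj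
    · simp [h, hj, hj.le, hj.ne]
    · simp [hj]
    · simp [h, hj.not_ge, hj.ne', hj.not_gt]
  · simp [h]

theorem ascentsBefore_last {m : ℕ} (μ : Equiv.Perm (Fin (m + 2))) :
    ascentsBefore μ (Fin.last (m + 1)) + descentNumber μ = m + 1 := by
  have h := Finset.card_filter_add_card_filter_not (s := (Finset.univ : Finset (Fin (m + 1))))
    (fun j => μ j.castSucc < μ j.succ)
  rw [descentNumber_eq_card]
  unfold ascentsBefore
  simp only [Fin.castSucc_lt_last, true_and]
  simp only [Finset.card_univ, Fintype.card_fin] at h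
  convert h using 4 with i
  rw [not_lt, le_iff_lt_or_eq, or_iff_left]
  intro h
  exact absurd (μ.injective h) (Fin.castSucc_lt_succ (i := i)).ne'

/-- It suffices to compare neighbours: at an ascent the extra `1` turns a weak inequality of digits
into a strict one, and at a descent nothing is added. -/
theorem lex_strictMono_iff {m : ℕ} (μ : Equiv.Perm (Fin (m + 2))) (a : Fin (m + 2) → ℕ) :
    (StrictMono fun i => toLex (a i, μ i)) ↔ StrictMono fun i => a i + ascentsBefore μ i := by
  rw [Fin.strictMono_iff_lt_succ, Fin.strictMono_iff_lt_succ]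
  refine forall_congr' fun i => ?_
  rw [ascentsBefore_succ, Prod.Lex.toLex_lt_toLex]
  split_ifs with h
  · simp only [h, and_true]; omega
  · simp only [h, and_false, or_false, add_zero, add_lt_add_iff_right]

theorem ascentsBefore_le {m : ℕ} (μ : Equiv.Perm (Fin (m + 2))) {b : Fin (m + 2) → ℕ}
    (hb : StrictMono b) (i : Fin (m + 2)) : ascentsBefore μ i ≤ b i := by
  induction i using Fin.induction with
  | zero => simp [ascentsBefore_zero]
  | succ i ih =>
    have := hb (Fin.castSucc_lt_succ (i := i))
    rw [ascentsBefore_succ]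
    split_ifs <;> omega

theorem ncard_digitSet {m k : ℕ} (hk : 1 ≤ k) (μ : Equiv.Perm (Fin (m + 2))) :
    (digitSet k μ).Finite ∧
      (digitSet k μ).ncard = (m + 1 + k - descentNumber μ).choose (m + 2) := by
  obtain ⟨hf, hc⟩ := ncard_strictMono_lt (m + 2) (m + 1 + k - descentNumber μ)
  have hlast := ascentsBefore_last μ
  have hfin : (digitSet k μ).Finite := by
    refine (Set.Finite.pi' (ι := Fin (m + 2)) (t := fun _ => Set.Iio k)
      fun _ => Set.finite_Iio k).subset ?_
    rintro b ⟨hb, _⟩ i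
    exact hb i
  refine ⟨hfin, ?_⟩
  rw [← hc]
  refine Set.ncard_congr (fun a _ i => a i + ascentsBefore μ i) ?_ ?_ ?_
  · rintro a ⟨ha, hmono⟩
    rw [lex_strictMono_iff] at hmono
    refine ⟨hmono, fun i => ?_⟩
    have h1 := hmono.monotone (Fin.le_last i)
    have h2 := ha (Fin.last (m + 1))
    show a i + ascentsBefore μ i < _
    omega
  · intro a b _ _ h
    funext i
    have := congrFun h i
    simpa using this
  · rintro b ⟨hb, hN⟩
    have hle := ascentsBefore_le μ hb
    have hsum : (fun i => b i - ascentsBefore μ i + ascentsBefore μ i) = b :=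
      funext fun i => Nat.sub_add_cancel (hle i)
    have hmono : StrictMono fun i => toLex (b i - ascentsBefore μ i, μ i) := by
      rw [lex_strictMono_iff, hsum]; exact hb
    refine ⟨fun i => b i - ascentsBefore μ i, ⟨fun i => ?_, hmono⟩, hsum⟩
    -- The digits are weakly increasing, so only the last one has to be bounded by `k`.
    have h1 : b i - ascentsBefore μ i ≤
        b (Fin.last (m + 1)) - ascentsBefore μ (Fin.last (m + 1)) := by
      have := hmono.monotone (Fin.le_last i)
      rw [Prod.Lex.toLex_le_toLex] at this
      simp only at this
      omega
    have h2 := hN (Fin.last (m + 1))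
    show b i - ascentsBefore μ i < k
    omega

/-! ### Periodic orbits and digit functions -/

theorem IsNCycle.forall_of_step {n : ℕ} {μ : Equiv.Perm (Fin n)} (hμ : IsNCycle μ)
    {P : Fin n → Prop} (hP : ∀ i, P i → P (μ i)) {i : Fin n} (hi : P i) (j : Fin n) : P j := by
  have hne : ∀ i, μ i ≠ i := fun i => by
    rw [← Equiv.Perm.mem_support, hμ.2]; exact Finset.mem_univ i
  obtain ⟨t, rfl⟩ := hμ.1.exists_pow_eq (hne i) (hne j)
  induction t with
  | zero => simpa using hi
  | succ t ih => rw [pow_succ', Equiv.Perm.mul_apply]; exact hP _ ih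

theorem IsNCycle.apply_ne {n : ℕ} {μ : Equiv.Perm (Fin n)} (hμ : IsNCycle μ) (i : Fin n) :
    μ i ≠ i := by
  rw [← Equiv.Perm.mem_support, hμ.2]; exact Finset.mem_univ i

theorem IsNCycle.not_strictMono {m : ℕ} {μ : Equiv.Perm (Fin (m + 2))} (hμ : IsNCycle μ) :
    ¬ StrictMono μ := by
  intro h
  have := (StrictMono.range_inj h strictMono_id).1 (by simp [μ.surjective.range_eq])
  exact hμ.apply_ne 0 (congrFun this 0)

/-- In the homogeneous system a maximal entry is `≤ 0` and a minimal one `≥ 0`, as `k > 1`;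
injectivity gives surjectivity in finite dimension. -/
theorem existsUnique_solution {n k : ℕ} (hk : 2 ≤ k) (μ : Equiv.Perm (Fin n)) (a : Fin n → ℝ) :
    ∃! x : Fin n → ℝ, ∀ i, (k : ℝ) * x i = x (μ i) + a i := by
  have hk' : (2 : ℝ) ≤ k := by exact_mod_cast hk
  let T : (Fin n → ℝ) →ₗ[ℝ] (Fin n → ℝ) :=
    { toFun := fun x i => (k : ℝ) * x i - x (μ i)
      map_add' := fun x y => by funext i; simp; ring
      map_smul' := fun c x => by funext i; simp; ring }
  have hT : ∀ x i, T x i = (k : ℝ) * x i - x (μ i) := fun _ _ => rfl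
  have hinj : Function.Injective T := by
    rw [injective_iff_map_eq_zero]
    intro x hx
    have hx' : ∀ i, (k : ℝ) * x i = x (μ i) := fun i => by
      have := congrFun hx i
      rw [hT, Pi.zero_apply] at this
      linarith
    funext i
    have : Nonempty (Fin n) := ⟨i⟩
    obtain ⟨j, hj⟩ := Finite.exists_max x
    obtain ⟨l, hl⟩ := Finite.exists_min x
    have h1 := hx' j
    have h2 := hj (μ j)
    have h3 := hx' l
    have h4 := hl (μ l)
    have h5 := hj i
    have h6 := hl i
    have h7 : x j ≤ 0 := by nlinarith
    have h8 : 0 ≤ x l := by nlinarith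
    show x i = 0
    linarith
  obtain ⟨x, hx⟩ := (LinearMap.injective_iff_surjective.1 hinj) a
  refine ⟨x, fun i => ?_, fun y hy => hinj ?_⟩
  · rw [← hx, hT]; ring
  · rw [hx]; funext i; rw [hT, hy i]; ring

section Solution

variable {m k : ℕ} {μ : Equiv.Perm (Fin (m + 2))} {a : Fin (m + 2) → ℕ} {x : Fin (m + 2) → ℝ}

theorem digitSet.lt_or {i j : Fin (m + 2)} (ha : a ∈ digitSet k μ) (hij : i < j) :
    a i < a j ∨ a i = a j ∧ μ i < μ j :=
  Prod.Lex.toLex_lt_toLex.1 (ha.2 hij)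

theorem digitSet.not_const (hμ : IsNCycle μ) (ha : a ∈ digitSet k μ) (c : ℕ) : ¬ ∀ i, a i = c := by
  intro h
  refine hμ.not_strictMono fun i j hij => ?_
  rcases digitSet.lt_or ha hij with h1 | h1
  · rw [h, h] at h1; exact absurd h1 (lt_irrefl _)
  · exact h1.2

theorem digitSet.cast_le (ha : a ∈ digitSet k μ) (i : Fin (m + 2)) : (a i : ℝ) ≤ k - 1 := by
  have : ((a i + 1 : ℕ) : ℝ) ≤ k := by exact_mod_cast ha.1 i
  push_cast at this
  linarith

theorem solution_mem_Icc (hk : 2 ≤ k) (ha : a ∈ digitSet k μ)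
    (hx : ∀ i, (k : ℝ) * x i = x (μ i) + a i) (i : Fin (m + 2)) : 0 ≤ x i ∧ x i ≤ 1 := by
  have hk' : (2 : ℝ) ≤ k := by exact_mod_cast hk
  obtain ⟨j, hj⟩ := Finite.exists_max x
  obtain ⟨l, hl⟩ := Finite.exists_min x
  have h1 := hx j
  have h2 := hj (μ j)
  have h3 := hx l
  have h4 := hl (μ l)
  have h5 := digitSet.cast_le ha j
  have h6 : (0 : ℝ) ≤ a l := Nat.cast_nonneg _
  have h7 : x j ≤ 1 := by nlinarith
  have h8 : 0 ≤ x l := by nlinarith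
  exact ⟨h8.trans (hl i), (hj i).trans h7⟩

/-- A value `0` or `1` would spread along the whole cycle and force all digits to be `0` or all to
be `k - 1`; constant digits would make `μ` increasing, hence the identity. -/
theorem solution_mem_Ioo (hk : 2 ≤ k) (hμ : IsNCycle μ) (ha : a ∈ digitSet k μ)
    (hx : ∀ i, (k : ℝ) * x i = x (μ i) + a i) (i : Fin (m + 2)) : 0 < x i ∧ x i < 1 := by
  have hk' : (2 : ℝ) ≤ k := by exact_mod_cast hk
  have hI := solution_mem_Icc hk ha hx
  constructor
  · refine lt_of_le_of_ne (hI i).1 fun h0 => digitSet.not_const hμ ha 0 fun j => ?_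
    have hz : ∀ j, 0 = x j := hμ.forall_of_step (P := fun j => 0 = x j) (fun j hj => by
      have h1 := hx j
      rw [← hj] at h1
      have h2 := (hI (μ j)).1
      have h3 : (0 : ℝ) ≤ a j := Nat.cast_nonneg _
      linarith) h0
    have h1 := hx j
    rw [← hz, ← hz] at h1
    have : (a j : ℝ) = 0 := by linarith
    exact_mod_cast this
  · refine lt_of_le_of_ne (hI i).2 fun h0 => digitSet.not_const hμ ha (k - 1) fun j => ?_
    have hz : ∀ j, x j = 1 := hμ.forall_of_step (P := fun j => x j = 1) (fun j hj => by
      have h1 := hx j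
      rw [hj] at h1
      have h2 := (hI (μ j)).2
      have h3 := digitSet.cast_le ha j
      linarith) h0
    have h1 := hx j
    rw [hz, hz] at h1
    have : (k : ℝ) = ((a j + 1 : ℕ) : ℝ) := by push_cast; linarith
    have : k = a j + 1 := by exact_mod_cast this
    omega

theorem solution_monotone (hk : 2 ≤ k) (ha : a ∈ digitSet k μ)
    (hx : ∀ i, (k : ℝ) * x i = x (μ i) + a i) : Monotone x := by
  have hk' : (2 : ℝ) ≤ k := by exact_mod_cast hk
  have hI := solution_mem_Icc hk ha hx
  have : Nonempty {p : Fin (m + 2) × Fin (m + 2) // p.1 < p.2} := ⟨⟨(0, 1), by simp⟩⟩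
  obtain ⟨⟨⟨i, j⟩, hij⟩, hmin⟩ := Finite.exists_min
    fun p : {p : Fin (m + 2) × Fin (m + 2) // p.1 < p.2} => x p.1.2 - x p.1.1
  simp only at hij hmin
  -- The smallest gap is nonnegative: a jump in digits outweighs the difference of the images, and
  -- for equal digits `k` times the gap is another gap, so at least the smallest.
  have hnn : 0 ≤ x j - x i := by
    have h1 := hx i
    have h2 := hx j
    rcases digitSet.lt_or ha hij with h | ⟨h, h'⟩
    · have h3 : ((a i + 1 : ℕ) : ℝ) ≤ a j := by exact_mod_cast h
      push_cast at h3
      have h4 := (hI (μ i)).2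
      have h5 := (hI (μ j)).1
      nlinarith
    · have h3 := hmin ⟨(μ i, μ j), h'⟩
      simp only at h3
      rw [h] at h1
      nlinarith
  intro p q hpq
  rcases hpq.eq_or_lt with rfl | h
  · exact le_rfl
  · have := hmin ⟨(p, q), h⟩
    simp only at this
    linarith

theorem solution_strictMono (hk : 2 ≤ k) (hμ : IsNCycle μ) (ha : a ∈ digitSet k μ)
    (hx : ∀ i, (k : ℝ) * x i = x (μ i) + a i) : StrictMono x := by
  have hI := solution_mem_Ioo hk hμ ha hx
  intro i j hij
  refine lt_of_le_of_ne (solution_monotone hk ha hx hij.le) fun heq => ?_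
  -- A coincidence propagates along `μ` with its order kept. Writing `j` as `(μ ^ t) i` makes the
  -- iterates of `μ ^ t` at `i` increase forever in a finite set.
  have hstep : ∀ p q, p < q → x p = x q → μ p < μ q ∧ x (μ p) = x (μ q) := by
    intro p q hpq h
    have h1 := hx p
    have h2 := hx q
    rw [h, h2] at h1
    rcases digitSet.lt_or ha hpq with h3 | ⟨h3, h4⟩
    · have h3 : ((a p + 1 : ℕ) : ℝ) ≤ a q := by exact_mod_cast h3
      push_cast at h3
      have h4 := (hI (μ p)).2
      have h5 := (hI (μ q)).1
      linarith
    · rw [h3] at h1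
      exact ⟨h4, by linarith⟩
  have hpow : ∀ t : ℕ, (μ ^ t) i < (μ ^ t) j ∧ x ((μ ^ t) i) = x ((μ ^ t) j) := by
    intro t
    induction t with
    | zero => simpa using ⟨hij, heq⟩
    | succ t ih =>
      rw [pow_succ', Equiv.Perm.mul_apply, Equiv.Perm.mul_apply]
      exact hstep _ _ ih.1 ih.2
  obtain ⟨t, rfl⟩ := hμ.1.exists_pow_eq (hμ.apply_ne i) (hμ.apply_ne j)
  have hmono : StrictMono fun r : ℕ => ((μ ^ t) ^ r) i := by
    refine strictMono_nat_of_lt_succ fun r => ?_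
    have := (hpow (t * r)).1
    rw [pow_succ, Equiv.Perm.mul_apply, ← pow_mul]
    exact this
  exact not_injective_infinite_finite _ hmono.injective

theorem mulMap_coe_eq_coe_iff (k : ℕ) (x y : ℝ) :
    mulMap k (x : UnitAddCircle) = (y : UnitAddCircle) ↔ ∃ z : ℤ, (k : ℝ) * x = y + z := by
  have : mulMap k (x : UnitAddCircle) = ((k * x : ℝ) : UnitAddCircle) := by
    rw [mulMap, ← nsmul_eq_mul, AddCircle.coe_nsmul]
  rw [this, eq_comm, QuotientAddGroup.eq, AddSubgroup.mem_zmultiples_iff]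
  refine exists_congr fun z => ?_
  rw [zsmul_eq_mul, mul_one]
  constructor <;> intro h <;> linarith

theorem exists_digits (hx : StrictMono x) (hI : ∀ i, 0 < x i ∧ x i < 1)
    (hm : ∀ i, mulMap k (x i : UnitAddCircle) = (x (μ i) : UnitAddCircle)) :
    ∃ a ∈ digitSet k μ, ∀ i, (k : ℝ) * x i = x (μ i) + (a i : ℕ) := by
  have hk0 : (0 : ℝ) ≤ k := Nat.cast_nonneg k
  choose z hz using fun i => (mulMap_coe_eq_coe_iff k (x i) (x (μ i))).1 (hm i)
  have hz0 : ∀ i, 0 ≤ z i := fun i => by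
    have h1 := hz i
    have h2 := (hI (μ i)).2
    have h3 := mul_nonneg hk0 (hI i).1.le
    have : (-1 : ℝ) < z i := by linarith
    have : -1 < z i := by exact_mod_cast this
    omega
  have hzk : ∀ i, z i < k := fun i => by
    have h1 := hz i
    have h2 := (hI (μ i)).1
    have h3 := mul_le_mul_of_nonneg_left (hI i).2.le hk0
    have : (z i : ℝ) < k := by linarith
    exact_mod_cast this
  have hmono : ∀ i j, i < j → z i ≤ z j ∧ (μ j < μ i → z i < z j) := fun i j hij => by
    have h1 := hz i
    have h2 := hz j
    have h3 := mul_le_mul_of_nonneg_left (hx hij).le hk0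
    have h4 := hI (μ i)
    have h5 := hI (μ j)
    constructor
    · have : (z i : ℝ) < z j + 1 := by linarith
      have : z i < z j + 1 := by exact_mod_cast this
      omega
    · intro h
      have h6 := hx h
      have : (z i : ℝ) < z j := by linarith
      exact_mod_cast this
  refine ⟨fun i => (z i).toNat, ⟨fun i => ?_, fun i j hij => ?_⟩, fun i => ?_⟩
  · have := hz0 i
    have := hzk i
    show (z i).toNat < k
    omega
  · rw [Prod.Lex.toLex_lt_toLex]
    have h1 := hmono i j hij
    have h2 := hz0 i
    have h3 := hz0 j
    simp only
    rcases lt_trichotomy (μ i) (μ j) with h | h | h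
    · simp only [h, and_true]; omega
    · exact absurd (μ.injective h) hij.ne
    · have := h1.2 h
      left; omega
  · rw [hz i]
    congr 1
    have : ((z i).toNat : ℤ) = z i := Int.toNat_of_nonneg (hz0 i)
    exact_mod_cast this.symm

end Solution

theorem eq_of_range_coe_eq {n : ℕ} {x y : Fin n → ℝ} (hx : StrictMono x) (hy : StrictMono y)
    (hxI : ∀ i, 0 < x i ∧ x i < 1) (hyI : ∀ i, 0 < y i ∧ y i < 1)
    (h : Set.range (fun i => (x i : UnitAddCircle)) = Set.range fun i => (y i : UnitAddCircle)) :
    x = y := by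
  rw [← StrictMono.range_inj hx hy]
  have key : ∀ {u v : Fin n → ℝ}, (∀ i, 0 < u i ∧ u i < 1) → (∀ i, 0 < v i ∧ v i < 1) →
      Set.range (fun i => (u i : UnitAddCircle)) = Set.range (fun i => (v i : UnitAddCircle)) →
      Set.range u ⊆ Set.range v := by
    rintro u v hu hv h _ ⟨i, rfl⟩
    have : (u i : UnitAddCircle) ∈ Set.range fun i => (v i : UnitAddCircle) := h ▸ ⟨i, rfl⟩
    obtain ⟨j, hj⟩ := this
    refine ⟨j, (AddCircle.coe_eq_coe_iff_of_mem_Ico (a := 0) ?_ ?_).1 hj⟩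
    · exact ⟨(hv j).1.le, by simpa using (hv j).2⟩
    · exact ⟨(hu i).1.le, by simpa using (hu i).2⟩
  exact (key hxI hyI h).antisymm (key hyI hxI h.symm)

theorem coe_injective_of_strictMono {n : ℕ} {x : Fin n → ℝ} (hx : StrictMono x)
    (hI : ∀ i, 0 < x i ∧ x i < 1) : Function.Injective fun i => (x i : UnitAddCircle) := by
  intro i j h
  refine hx.injective ((AddCircle.coe_eq_coe_iff_of_mem_Ico (a := 0) ?_ ?_).1 h)
  · exact ⟨(hI i).1.le, by simpa using (hI i).2⟩
  · exact ⟨(hI j).1.le, by simpa using (hI j).2⟩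

theorem Realizes.unique {k n : ℕ} {O : Set UnitAddCircle} {μ μ' : Equiv.Perm (Fin n)}
    (h : Realizes k O μ) (h' : Realizes k O μ') : μ = μ' := by
  obtain ⟨x, hx, hI, rfl, hm⟩ := h
  obtain ⟨y, hy, hJ, hO, hm'⟩ := h'
  obtain rfl := eq_of_range_coe_eq hx hy hI hJ hO
  ext i : 1
  exact coe_injective_of_strictMono hx hI ((hm i).symm.trans (hm' i))

theorem Realizes.isPeriodicOrbit {k m : ℕ} {O : Set UnitAddCircle} {μ : Equiv.Perm (Fin (m + 2))}
    (hμ : IsNCycle μ) (h : Realizes k O μ) : IsPeriodicOrbit k (m + 2) O := by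
  obtain ⟨x, hx, hI, rfl, hm⟩ := h
  have hinj := coe_injective_of_strictMono hx hI
  have hit : ∀ j : ℕ, (mulMap k)^[j] (x 0 : UnitAddCircle) = (x ((μ ^ j) 0) : UnitAddCircle) := by
    intro j
    induction j with
    | zero => simp
    | succ j ih =>
      rw [Function.iterate_succ_apply', ih, hm, pow_succ', Equiv.Perm.mul_apply]
  refine ⟨(x 0 : UnitAddCircle), ?_, ?_⟩
  · have hper : ∀ j : ℕ, Function.IsPeriodicPt (mulMap k) j (x 0 : UnitAddCircle) ↔
        m + 2 ∣ j := by
      intro j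
      have ho : orderOf μ = m + 2 := by rw [hμ.1.orderOf, hμ.2]; simp
      have hd : m + 2 ∣ j ↔ orderOf μ ∣ j := by rw [ho]
      rw [hd, orderOf_dvd_iff_pow_eq_one, hμ.1.pow_eq_one_iff, Function.IsPeriodicPt,
        Function.IsFixedPt, hit]
      constructor
      · intro h
        exact ⟨0, hμ.apply_ne 0, hinj h⟩
      · intro h
        have := hμ.1.pow_eq_one_iff.2 h
        rw [this]; rfl
    refine Nat.dvd_antisymm ?_ ((hper _).1 (Function.isPeriodicPt_minimalPeriod _ _))
    exact Function.IsPeriodicPt.minimalPeriod_dvd ((hper _).2 dvd_rfl)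
  · simp_rw [hit]
    ext y
    constructor
    · rintro ⟨i, rfl⟩
      obtain ⟨t, rfl⟩ := hμ.1.exists_pow_eq (hμ.apply_ne 0) (hμ.apply_ne i)
      exact ⟨t, rfl⟩
    · rintro ⟨t, rfl⟩
      exact ⟨_, rfl⟩

theorem ncard_realizes {m k : ℕ} (hk : 2 ≤ k) {μ : Equiv.Perm (Fin (m + 2))} (hμ : IsNCycle μ) :
    {O | Realizes k O μ}.Finite ∧
      {O | Realizes k O μ}.ncard = (m + 1 + k - descentNumber μ).choose (m + 2) := by
  obtain ⟨hf, hc⟩ := ncard_digitSet (by omega : 1 ≤ k) μ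
  choose sol hsol huniq using fun a : Fin (m + 2) → ℕ =>
    existsUnique_solution hk μ fun i => (a i : ℝ)
  have himage : {O | Realizes k O μ} =
      (fun a => Set.range fun i => (sol a i : UnitAddCircle)) '' digitSet k μ := by
    ext O
    constructor
    · rintro ⟨x, hx, hI, rfl, hm⟩
      obtain ⟨a, ha, hxa⟩ := exists_digits hx hI hm
      exact ⟨a, ha, by rw [huniq a x hxa]⟩
    · rintro ⟨a, ha, rfl⟩
      refine ⟨sol a, solution_strictMono hk hμ ha (hsol a), solution_mem_Ioo hk hμ ha (hsol a),
        rfl, fun i => (mulMap_coe_eq_coe_iff _ _ _).2 ⟨a i, ?_⟩⟩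
      rw [hsol a i]; simp
  rw [himage, ← hc]
  refine ⟨hf.image _, Set.InjOn.ncard_image fun a ha b hb h => ?_⟩
  have := eq_of_range_coe_eq (solution_strictMono hk hμ ha (hsol a))
    (solution_strictMono hk hμ hb (hsol b)) (solution_mem_Ioo hk hμ ha (hsol a))
    (solution_mem_Ioo hk hμ hb (hsol b)) h
  funext i
  have h1 := hsol a i
  have h2 := hsol b i
  rw [this] at h1
  have : (a i : ℝ) = b i := by linarith
  exact_mod_cast this

/-! ### Summing over the combinatorial type -/

theorem nsmul_one_eq_ofNat {m : ℕ} (t : ℕ) : t • (1 : Fin (m + 2)) = Fin.ofNat (m + 2) t := by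
  induction t with
  | zero => rfl
  | succ t ih =>
    rw [succ_nsmul, ih]
    ext
    simp [Fin.val_add]

theorem mem_rotationGroup_iff {m : ℕ} (g : Equiv.Perm (Fin (m + 2))) :
    g ∈ rotationGroup (m + 2) ↔ ∃ c, Equiv.addRight c = g := by
  have hrho : rho (m + 2) = Equiv.addRight 1 := by
    ext i : 1
    simp [rho]
  rw [rotationGroup, hrho, Subgroup.mem_zpowers_iff]
  simp_rw [Equiv.zsmul_addRight]
  constructor
  · rintro ⟨z, rfl⟩
    exact ⟨_, rfl⟩
  · rintro ⟨c, rfl⟩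
    refine ⟨(c.val : ℤ), ?_⟩
    refine congrArg Equiv.addRight ?_
    rw [natCast_zsmul, nsmul_one_eq_ofNat, Fin.ofNat_val_eq_self]

theorem combinatorialType_eq_range {m : ℕ} (ν : Equiv.Perm (Fin (m + 2))) :
    combinatorialType ν = Set.range (rotConj ν) := by
  ext μ
  constructor
  · rintro ⟨g, hg, rfl⟩
    obtain ⟨c, rfl⟩ := (mem_rotationGroup_iff g).1 hg
    exact ⟨c, rfl⟩
  · rintro ⟨c, rfl⟩
    exact ⟨_, (mem_rotationGroup_iff _).2 ⟨c, rfl⟩, rfl⟩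

theorem symOrder_eq_card {m : ℕ} (ν : Equiv.Perm (Fin (m + 2))) :
    symOrder ν = (Finset.univ.filter fun c => rotConj ν c = ν).card := by
  rw [symOrder, ← Set.ncard_coe_finset]
  symm
  refine Set.ncard_congr (fun c _ => Equiv.addRight c) ?_ ?_ ?_
  · intro c hc
    exact ⟨(mem_rotationGroup_iff _).2 ⟨c, rfl⟩, (Finset.mem_filter.1 hc).2⟩
  · intro a b _ _ h
    simpa using DFunLike.congr_fun h 0
  · rintro g ⟨hg, hgν⟩
    obtain ⟨c, rfl⟩ := (mem_rotationGroup_iff g).1 hg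
    exact ⟨c, Finset.mem_filter.2 ⟨Finset.mem_univ c, hgν⟩, rfl⟩

theorem rotConj_sub_eq_iff {m : ℕ} (ν : Equiv.Perm (Fin (m + 2))) (c c₀ : Fin (m + 2)) :
    rotConj ν (c - c₀) = ν ↔ rotConj ν c = rotConj ν c₀ := by
  have h : rotConj ν c = rotConj (rotConj ν (c - c₀)) c₀ := by
    ext i : 1
    simp only [rotConj_apply, sub_sub, add_assoc, sub_add_cancel,
      add_sub_cancel]
  rw [h]
  unfold rotConj
  rw [mul_left_inj, mul_right_inj]

/-- The fibres of `rotConj ν` are cosets of the stabilizer. -/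
theorem card_rotConj_eq {m : ℕ} (ν : Equiv.Perm (Fin (m + 2))) (c₀ : Fin (m + 2)) :
    (Finset.univ.filter fun c => rotConj ν c = rotConj ν c₀).card = symOrder ν := by
  rw [symOrder_eq_card, Finset.card_filter, Finset.card_filter,
    ← Equiv.sum_comp (Equiv.subRight c₀) fun c => if rotConj ν c = ν then 1 else 0]
  simp only [Equiv.subRight_apply, rotConj_sub_eq_iff]

theorem IsNCycle.rotConj {m : ℕ} {ν : Equiv.Perm (Fin (m + 2))} (hν : IsNCycle ν)
    (c : Fin (m + 2)) : IsNCycle (rotConj ν c) := by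
  refine ⟨hν.1.conj, ?_⟩
  rw [CircleCycles.rotConj, Equiv.Perm.support_conj, hν.2, Finset.map_univ_equiv]

theorem setOf_realizesType_eq {m : ℕ} (k : ℕ) {ν : Equiv.Perm (Fin (m + 2))} (hν : IsNCycle ν) :
    {O | IsPeriodicOrbit k (m + 2) O ∧ RealizesType k O ν} =
      ⋃ μ : (Finset.univ.image (rotConj ν) : Finset (Equiv.Perm (Fin (m + 2)))),
        {O | Realizes k O μ.1} := by
  ext O
  simp only [RealizesType, combinatorialType_eq_range, Set.mem_iUnion]
  constructor
  · rintro ⟨-, μ, ⟨c, rfl⟩, h⟩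
    exact ⟨⟨_, Finset.mem_image_of_mem _ (Finset.mem_univ c)⟩, h⟩
  · rintro ⟨⟨μ, hμ⟩, h⟩
    obtain ⟨c, _, rfl⟩ := Finset.mem_image.1 hμ
    exact ⟨Realizes.isPeriodicOrbit (hν.rotConj c) h, _, ⟨c, rfl⟩, h⟩

theorem symOrder_mul_ncard {m k : ℕ} (hk : 2 ≤ k) {ν : Equiv.Perm (Fin (m + 2))}
    (hν : IsNCycle ν) :
    {O | IsPeriodicOrbit k (m + 2) O ∧ RealizesType k O ν}.Finite ∧
      symOrder ν * {O | IsPeriodicOrbit k (m + 2) O ∧ RealizesType k O ν}.ncard =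
        ∑ c, (m + 1 + k - descentNumber (rotConj ν c)).choose (m + 2) := by
  rw [setOf_realizesType_eq k hν]
  have hfin : ∀ μ : (Finset.univ.image (rotConj ν) : Finset (Equiv.Perm (Fin (m + 2)))),
      {O | Realizes k O μ.1}.Finite := by
    rintro ⟨μ, hμ⟩
    obtain ⟨c, _, rfl⟩ := Finset.mem_image.1 hμ
    exact (ncard_realizes hk (hν.rotConj c)).1
  refine ⟨Set.finite_iUnion hfin, ?_⟩
  rw [Set.ncard_iUnion_of_finite hfin, finsum_eq_sum_of_fintype,
    Finset.sum_coe_sort _ fun μ => {O | Realizes k O μ}.ncard, Finset.mul_sum]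
  · simp_rw [← fun c => (ncard_realizes hk (hν.rotConj c)).2]
    rw [Finset.sum_comp (fun μ => {O | Realizes k O μ}.ncard) (rotConj ν)]
    refine Finset.sum_congr rfl fun μ hμ => ?_
    obtain ⟨c, _, rfl⟩ := Finset.mem_image.1 hμ
    rw [card_rotConj_eq, smul_eq_mul]
  · intro μ μ' hne
    refine Set.disjoint_left.2 fun O hO hO' => hne ?_
    exact Subtype.ext (Realizes.unique hO hO')

theorem sum_choose_eq {m k d : ℕ} {ν : Equiv.Perm (Fin (m + 2))} (hν : IsNCycle ν)
    (hd : degree ν = d) (hk : d ≤ k) :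
    ∑ c, (m + 1 + k - descentNumber (rotConj ν c)).choose (m + 2) =
      (k - 1) * (m + 1 + k - d).choose (m + 1) := by
  have hcount := card_rotConj_lt_add_one ν hν.apply_ne
  rw [hd] at hcount
  have hterm : ∀ c, (m + 1 + k - descentNumber (rotConj ν c)).choose (m + 2) =
      (m + 1 + k - d).choose (m + 2) +
        if rotConj ν c 0 < rotConj ν c (Fin.last (m + 1)) then
          (m + 1 + k - d).choose (m + 1) else 0 := by
    intro c
    have h := degree_eq_descentNumber_add (rotConj ν c)
    rw [degree_rotConj, hd] at h
    split_ifs at h ⊢ with hc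
    · rw [show m + 1 + k - descentNumber (rotConj ν c) = (m + 1 + k - d) + 1 by omega,
        Nat.choose_succ_succ, add_comm]
    · rw [h, add_zero, add_zero]
  simp_rw [hterm]
  -- With `N = m + 1 + k - d`, `(m + 2) * N.choose (m + 2) = (k - d) * N.choose (m + 1)`, and `(k -
  -- d) + (d - 1) = k - 1`.
  rw [Finset.sum_add_distrib, Finset.sum_const, ← Finset.sum_filter, Finset.sum_const,
    Finset.card_univ, Fintype.card_fin, smul_eq_mul, smul_eq_mul, mul_comm (m + 2),
    Nat.choose_succ_right_eq, mul_comm (Nat.choose _ _), ← add_mul]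
  congr 1
  omega

end CircleCycles

theorem mainTheorem8 (n : ℕ) (hn : 2 ≤ n) (d s k : ℕ) (ν : Equiv.Perm (Fin n))
    (hν : CircleCycles.IsNCycle ν) (hd : CircleCycles.degree ν = d)
    (hs : CircleCycles.symOrder ν = s) (hk : max d 2 ≤ k) :
    {O : Set UnitAddCircle | CircleCycles.IsPeriodicOrbit k n O ∧
        CircleCycles.RealizesType k O ν}.Finite ∧
      (Set.ncard {O : Set UnitAddCircle | CircleCycles.IsPeriodicOrbit k n O ∧
        CircleCycles.RealizesType k O ν} : ℚ) =
        ((k : ℚ) - 1) / (s : ℚ) * (Nat.choose (n + k - d - 1) (n - 1) : ℚ) := by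
  obtain ⟨m, rfl⟩ := Nat.exists_eq_add_of_le' hn
  have hdk : d ≤ k := (le_max_left _ _).trans hk
  have hk2 : 2 ≤ k := (le_max_right _ _).trans hk
  obtain ⟨hfin, hcard⟩ := CircleCycles.symOrder_mul_ncard hk2 hν
  refine ⟨hfin, ?_⟩
  rw [CircleCycles.sum_choose_eq hν hd hdk, hs] at hcard
  have hs0 : s ≠ 0 := by
    rw [← hs, ← CircleCycles.card_rotConj_eq ν 0]
    exact Finset.card_ne_zero.2 ⟨0, by simp⟩
  have hs0' : (s : ℚ) ≠ 0 := by exact_mod_cast hs0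
  have hcard' := congrArg (Nat.cast : ℕ → ℚ) hcard
  push_cast [Nat.cast_sub (by omega : 1 ≤ k)] at hcard'
  rw [show m + 2 + k - d - 1 = m + 1 + k - d by omega, show m + 2 - 1 = m + 1 by omega,
    div_mul_eq_mul_div, eq_div_iff hs0', ← hcard', mul_comm]
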